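/- Let $A_0\in\mathbb{R}^{n\times n}$ and $B\in\mathbb{R}^{n\times m}$ be real matrices such that the pair $(A_0,B)$ is uncontrollable, i.e. $\operatorname{rank}[B,\,A_0B,\,\dots,\,A_0^{n-1}B]<n$. For real symmetric $X\in\mathbb{R}^{n\times n}$ put $$\mathrm{Ric}(X)=-A_0^TX-XA_0+XBB^TX ,$$ and let $\mathcal{S}=\{X\in\mathbb{R}^{n\times n}: X=X^T,\ \mathrm{Ric}(X)\le 0\}$ be the solution set of the algebraic Riccati inequality (ARI). Here $M\le N$ means that $N-M$ is symmetric positive semidefinite, and $\mathcal{S}$ is called bounded below (above) if there is a matrix $K$ with $K\le X$ ($X\le K$) for all $X\in\mathcal{S}$. By a change of basis, $A_0$ and $B$ can be brought to the form $$\begin{bmatrix}A_{11}&A_{12}\\0&A_{22}\end{bmatrix},\qquad \begin{bmatrix}B_1\\0\end{bmatrix}$$ with $(A_{11},B_1)$ controllable; the (complex) eigenvalues of $A_{22}$ are the uncontrollable eigenvalues of $(A_0,B)$. 1. If all uncontrollable eigenvalues lie in the open right half-plane, then $\mathcal{S}$ is bounded below. 2. If all uncontrollable eigenvalues lie in the open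 left half-plane, then $\mathcal{S}$ is bounded above. 3. If there is an uncontrollable eigenvalue in the open right half-plane and an uncontrollable eigenvalue in the open left half-plane, then $\mathcal{S}$ is neither bounded below nor bounded above. -/

import Mathlib

open scoped MatrixOrder

namespace Riccati

/-- The controllability matrix `[B, AB, …, Aⁿ⁻¹B]` of the pair `(A, B)`; its columns are indexed by
pairs (power of `A`, column of `B`). -/
def controllabilityMatrix {n m : ℕ} (A : Matrix (Fin n) (Fin n) ℝ) (B : Matrix (Fin n) (Fin m) ℝ) :
    Matrix (Fin n) (Fin n × Fin m) ℝ :=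
  Matrix.of fun i p => (A ^ (p.1 : ℕ) * B) i p.2

/-- The pair `(A, B)` is controllable: `rank [B, AB, …, Aⁿ⁻¹B] = n`. -/
def IsControllable {n m : ℕ} (A : Matrix (Fin n) (Fin n) ℝ) (B : Matrix (Fin n) (Fin m) ℝ) : Prop :=
  (controllabilityMatrix A B).rank = n

/-- The invertible matrix `T` (with inverse `S`) is a change of basis bringing `(A, B)` to the form
`T⁻¹ A T = [A₁₁ A₁₂; 0 A₂₂]`, `T⁻¹ B = [B₁; 0]` with `(A₁₁, B₁)` controllable. -/
structure IsControllabilityDecomposition {n m r s : ℕ}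
    (A : Matrix (Fin n) (Fin n) ℝ) (B : Matrix (Fin n) (Fin m) ℝ)
    (T : Matrix (Fin n) (Fin r ⊕ Fin s) ℝ) (S : Matrix (Fin r ⊕ Fin s) (Fin n) ℝ)
    (A₁₁ : Matrix (Fin r) (Fin r) ℝ) (A₁₂ : Matrix (Fin r) (Fin s) ℝ)
    (A₂₂ : Matrix (Fin s) (Fin s) ℝ) (B₁ : Matrix (Fin r) (Fin m) ℝ) : Prop where
  mul_inv : T * S = 1
  inv_mul : S * T = 1
  conj_A : S * A * T = Matrix.fromBlocks A₁₁ A₁₂ 0 A₂₂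
  conj_B : S * B = Matrix.fromRows B₁ 0
  controllable : IsControllable A₁₁ B₁

/-- `z ∈ ℂ` is an uncontrollable eigenvalue of `(A, B)`: it is an eigenvalue of the block `A₂₂` of a
controllability decomposition of `(A, B)`. -/
def IsUncontrollableEigenvalue {n m : ℕ} (A : Matrix (Fin n) (Fin n) ℝ)
    (B : Matrix (Fin n) (Fin m) ℝ) (z : ℂ) : Prop :=
  ∃ (r s : ℕ) (T : Matrix (Fin n) (Fin r ⊕ Fin s) ℝ) (S : Matrix (Fin r ⊕ Fin s) (Fin n) ℝ)
    (A₁₁ : Matrix (Fin r) (Fin r) ℝ) (A₁₂ : Matrix (Fin r) (Fin s) ℝ)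
    (A₂₂ : Matrix (Fin s) (Fin s) ℝ) (B₁ : Matrix (Fin r) (Fin m) ℝ),
    IsControllabilityDecomposition A B T S A₁₁ A₁₂ A₂₂ B₁ ∧
      Module.End.HasEigenvalue (Matrix.toLin' (A₂₂.map (fun x : ℝ => (x : ℂ)))) z

/-- `Ric(X) = -AᵀX - XA + XBBᵀX`. -/
def ric {n m : ℕ} (A : Matrix (Fin n) (Fin n) ℝ) (B : Matrix (Fin n) (Fin m) ℝ)
    (X : Matrix (Fin n) (Fin n) ℝ) : Matrix (Fin n) (Fin n) ℝ :=
  -(A.transpose * X) - X * A + X * B * B.transpose * X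

/-- The real symmetric solutions of the algebraic Riccati inequality `Ric(X) ≤ 0`. Here `≤` is the
Loewner order on matrices: `M ≤ N` means that `N - M` is (symmetric) positive semidefinite. -/
def ariSolutionSet {n m : ℕ} (A : Matrix (Fin n) (Fin n) ℝ) (B : Matrix (Fin n) (Fin m) ℝ) :
    Set (Matrix (Fin n) (Fin n) ℝ) :=
  {X | X.IsSymm ∧ ric A B X ≤ 0}

end Riccati

namespace Riccati

open Matrix

variable {ι κ : Type*}

/-! Uncontrollable eigenvalues are the `z` having a left eigenvector `v` of `A` with `vB = 0`
(Hautus test); the Kalman decomposition links the two descriptions.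

Lower bound: if `Z > 0` and `AZ + ZAᵀ + γBBᵀ > 0`, then every solution satisfies `X ≥ -max(γ,0)
Z⁻¹`. Otherwise `Xv = -d Z⁻¹v` with `v ≠ 0` and `d > max(γ,0)`, and testing `Ric(X) ≤ 0` on `v`
gives a contradiction. By Hahn-Banach, such `Z, γ` fail to exist only if some `Q ≥ 0`, `Q ≠ 0`, has
`QB = 0` and `AᵀQ + QA ≤ 0`; the range of `Q` is then `Aᵀ`-invariant and contains a mode with `Re z
≤ 0`. The upper bound follows from `(A, X) ↦ (-A, -X)`.

Unboundedness: a mode `p + iq` with `Re z > 0` gives a ray of solutions `c(ppᵀ + qqᵀ)`, `c ≥ 0`; the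
same symmetry treats `Re z < 0`. -/

/-! ### Theorem of alternatives by convex separation -/

lemma dotProduct_self_pos [Fintype ι] {x : ι → ℝ} (hx : x ≠ 0) : 0 < x ⬝ᵥ x := by
  simpa using dotProduct_star_self_pos_iff.2 hx

lemma dotProduct_conj_add [Fintype ι] (M N : Matrix ι ι ℝ) (hN : N.IsSymm) (x : ι → ℝ) :
    x ⬝ᵥ (Mᵀ * N + N * M) *ᵥ x = 2 * (N *ᵥ x ⬝ᵥ M *ᵥ x) := by
  have h1 : x ⬝ᵥ (N * M) *ᵥ x = N *ᵥ x ⬝ᵥ M *ᵥ x := by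
    rw [← mulVec_mulVec, dotProduct_mulVec, ← mulVec_transpose, hN.eq]
  have h2 : x ⬝ᵥ (Mᵀ * N) *ᵥ x = N *ᵥ x ⬝ᵥ M *ᵥ x := by
    rw [← mulVec_mulVec, dotProduct_mulVec, vecMul_transpose, dotProduct_comm]
  rw [add_mulVec, dotProduct_add, h1, h2]; ring

/-- Homogeneity reduces the condition to the compact unit sphere, where strict positivity survives
small perturbations. -/
lemma isOpen_forall_quadratic_pos [Fintype ι] :
    IsOpen {M : Matrix ι ι ℝ | ∀ x : ι → ℝ, x ≠ 0 → 0 < x ⬝ᵥ M *ᵥ x} := by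
  have hs : {M : Matrix ι ι ℝ | ∀ x : ι → ℝ, x ≠ 0 → 0 < x ⬝ᵥ M *ᵥ x} =
      {M | ∀ x ∈ Metric.sphere (0 : ι → ℝ) 1, 0 < x ⬝ᵥ M *ᵥ x} := by
    ext M
    refine ⟨fun h x hx => h x ?_, fun h x hx => ?_⟩
    · rintro rfl; simp at hx
    · have hn : 0 < ‖x‖ := norm_pos_iff.2 hx
      have := h (‖x‖⁻¹ • x) (by simp [norm_smul, hn.ne'])
      rw [mulVec_smul, dotProduct_smul, smul_dotProduct] at this
      simp only [smul_eq_mul] at this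
      have h' := mul_pos (mul_pos hn hn) this
      field_simp at h'
      exact h'
  rw [hs, isOpen_iff_eventually]
  intro M hM
  refine (isCompact_sphere (0 : ι → ℝ) 1).eventually_forall_of_forall_eventually fun x hx => ?_
  have hc : Continuous fun p : Matrix ι ι ℝ × (ι → ℝ) => p.2 ⬝ᵥ p.1 *ᵥ p.2 :=
    continuous_snd.dotProduct (continuous_fst.matrix_mulVec continuous_snd)
  exact hc.continuousAt.eventually (lt_mem_nhds (hM x hx))

/-- The symmetric matrix `Q` with `f M = -tr (Q M)` for symmetric `M`. -/
noncomputable def negSymmRep [DecidableEq ι] (f : Matrix ι ι ℝ →ₗ[ℝ] ℝ) : Matrix ι ι ℝ :=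
  Matrix.of fun i j => -(f (single i j 1) + f (single j i 1)) / 2

lemma isSymm_negSymmRep [DecidableEq ι] (f : Matrix ι ι ℝ →ₗ[ℝ] ℝ) : (negSymmRep f).IsSymm := by
  ext i j
  simp [negSymmRep, add_comm]

lemma apply_eq_neg_trace [Fintype ι] [DecidableEq ι] (f : Matrix ι ι ℝ →ₗ[ℝ] ℝ) {M : Matrix ι ι ℝ} (hM : M.IsSymm) :
    f M = -(negSymmRep f * M).trace := by
  have h0 : f M = ∑ i, ∑ j, M i j * f (single i j 1) := by
    conv_lhs => rw [matrix_eq_sum_single M]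
    simp only [map_sum]
    refine Finset.sum_congr rfl fun i _ => Finset.sum_congr rfl fun j _ => ?_
    rw [← smul_eq_mul, ← map_smul, smul_single, smul_eq_mul, mul_one]
  have h1 : f M = ∑ i, ∑ j, M i j * f (single j i 1) := by
    rw [h0, Finset.sum_comm]
    refine Finset.sum_congr rfl fun i _ => Finset.sum_congr rfl fun j _ => ?_
    rw [hM.apply]
  have h2 : (negSymmRep f * M).trace =
      ∑ i, ∑ j, -(M i j * f (single i j 1) + M i j * f (single j i 1)) / 2 := by
    simp only [trace, diag_apply, mul_apply, negSymmRep, of_apply]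
    refine Finset.sum_congr rfl fun i _ => Finset.sum_congr rfl fun j _ => ?_
    rw [hM.apply]; ring
  rw [h2]
  simp only [← Finset.sum_div, Finset.sum_neg_distrib, Finset.sum_add_distrib, ← h0, ← h1]
  ring

lemma trace_mul_vecMulVec_self [Fintype ι] (Q : Matrix ι ι ℝ) (x : ι → ℝ) :
    (Q * vecMulVec x x).trace = x ⬝ᵥ Q *ᵥ x := by
  rw [mul_vecMulVec, trace_vecMulVec, dotProduct_comm]

lemma nonneg_of_forall_pos_le_mul {a b : ℝ} (h : ∀ ε : ℝ, 0 < ε → 0 ≤ a + ε * b) : 0 ≤ a := by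
  have hc : Filter.Tendsto (fun ε : ℝ => a + ε * b) (nhdsWithin 0 (Set.Ioi 0)) (nhds a) := by
    have : Continuous fun ε : ℝ => a + ε * b := by fun_prop
    simpa using (this.tendsto 0).mono_left nhdsWithin_le_nhds
  exact ge_of_tendsto hc (eventually_mem_nhdsWithin.mono fun ε hε => h ε hε)

/-- Theorem of alternatives for the Lyapunov inequality modulo the range of `B`. -/
theorem exists_posDef_or_exists_posSemidef [Fintype ι] [DecidableEq ι] [Fintype κ]
    (A : Matrix ι ι ℝ) (B : Matrix ι κ ℝ) :
    (∃ (Z : Matrix ι ι ℝ) (γ : ℝ), Z.PosDef ∧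
      ∀ x : ι → ℝ, x ≠ 0 → 0 < x ⬝ᵥ (A * Z + Z * Aᵀ + γ • (B * Bᵀ)) *ᵥ x) ∨
    ∃ Q : Matrix ι ι ℝ, Q.PosSemidef ∧ Q ≠ 0 ∧ Q * B = 0 ∧ (-(Aᵀ * Q + Q * A)).PosSemidef := by
  by_cases hex : ∃ (Z : Matrix ι ι ℝ) (γ : ℝ), Z.PosDef ∧
      ∀ x : ι → ℝ, x ≠ 0 → 0 < x ⬝ᵥ (A * Z + Z * Aᵀ + γ • (B * Bᵀ)) *ᵥ x
  · exact Or.inl hex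
  right
  let U := {M : Matrix ι ι ℝ | ∀ x : ι → ℝ, x ≠ 0 → 0 < x ⬝ᵥ M *ᵥ x}
  let V := {M : Matrix ι ι ℝ | ∃ (Z : Matrix ι ι ℝ) (γ : ℝ), Z.PosDef ∧
    M = A * Z + Z * Aᵀ + γ • (B * Bᵀ)}
  have hU : Convex ℝ U := by
    intro M hM N hN a b ha hb hab x hx
    have h1 := hM x hx
    have h2 := hN x hx
    rw [add_mulVec, smul_mulVec, smul_mulVec, dotProduct_add, dotProduct_smul, dotProduct_smul]
    rcases ha.eq_or_lt with rfl | ha'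
    · obtain rfl : b = 1 := by linarith
      simpa using h2
    · have := mul_pos ha' h1
      have := mul_nonneg hb h2.le
      simp only [smul_eq_mul]; linarith
  have hV : Convex ℝ V := by
    rintro _ ⟨Z, γ, hZ, rfl⟩ _ ⟨Z', γ', hZ', rfl⟩ a b ha hb hab
    refine ⟨a • Z + b • Z', a * γ + b * γ', ?_, ?_⟩
    · rcases ha.eq_or_lt with rfl | ha'
      · obtain rfl : b = 1 := by linarith
        simpa using hZ'
      · exact (hZ.smul ha').add_posSemidef (hZ'.posSemidef.smul hb)
    · simp only [mul_add, add_mul, smul_add, add_smul, mul_smul, smul_mul_assoc, mul_smul_comm]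
      abel
  have hd : Disjoint U V := by
    rw [Set.disjoint_left]
    rintro M hM ⟨Z, γ, hZ, rfl⟩
    exact hex ⟨Z, γ, hZ, hM⟩
  obtain ⟨f, u, hfU, hfV⟩ := geometric_hahn_banach_open hU isOpen_forall_quadratic_pos hV hd
  set Q := negSymmRep f.toLinearMap
  have hQs : Q.IsSymm := isSymm_negSymmRep _
  have hf : ∀ {M : Matrix ι ι ℝ}, M.IsSymm → f M = -(Q * M).trace := fun hM =>
    apply_eq_neg_trace f.toLinearMap hM
  have hone : (1 : Matrix ι ι ℝ) ∈ U := fun x hx => by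
    rw [one_mulVec]; exact dotProduct_self_pos hx
  have hsU : ∀ c : ℝ, 0 < c → ∀ M ∈ U, c • M ∈ U := fun c hc M hM x hx => by
    rw [smul_mulVec, dotProduct_smul]; exact mul_pos hc (hM x hx)
  -- `U` is a cone: scaling its elements towards `0` gives `u ≥ 0`, scaling them to infinity gives
  -- `f ≤ 0` on `U`.
  have hu : 0 ≤ u := by
    refine nonneg_of_forall_pos_le_mul (b := -f 1) fun ε hε => ?_
    have := hfU _ (hsU ε hε 1 hone)
    rw [map_smul, smul_eq_mul] at this; linarith
  have hU0 : ∀ M ∈ U, f M ≤ 0 := fun M hM => by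
    have : 0 ≤ -f M := by
      refine nonneg_of_forall_pos_le_mul (b := u) fun ε hε => ?_
      have := hfU _ (hsU ε⁻¹ (inv_pos.2 hε) M hM)
      rw [map_smul, smul_eq_mul, inv_mul_lt_iff₀ hε] at this; linarith
    linarith
  have hsymm : ∀ (x : ι → ℝ) (c : ℝ), (vecMulVec x x + c • (1 : Matrix ι ι ℝ)).IsSymm := by
    intro x c
    ext i j
    simp [vecMulVec_apply, mul_comm, one_apply, eq_comm]
  have hQnn : ∀ x : ι → ℝ, 0 ≤ x ⬝ᵥ Q *ᵥ x := fun x => by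
    refine nonneg_of_forall_pos_le_mul (b := Q.trace) fun ε hε => ?_
    -- `xxᵀ` lies only on the boundary of `U`, hence the perturbation by `ε`.
    have hm : vecMulVec x x + ε • (1 : Matrix ι ι ℝ) ∈ U := fun y hy => by
      rw [add_mulVec, smul_mulVec, dotProduct_add, dotProduct_smul, one_mulVec]
      have h1 : y ⬝ᵥ vecMulVec x x *ᵥ y = (x ⬝ᵥ y) ^ 2 := by
        rw [vecMulVec_mulVec, dotProduct_comm y]; simp [sq]
      rw [h1]
      have := mul_pos hε (dotProduct_self_pos hy)
      rw [smul_eq_mul]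
      linarith [sq_nonneg (x ⬝ᵥ y)]
    have h2 := hU0 _ hm
    rw [hf (hsymm x ε), mul_add, trace_add, trace_mul_vecMulVec_self, mul_smul_comm, mul_one,
      trace_smul, smul_eq_mul] at h2
    linarith
  have hQ : Q.PosSemidef := .of_dotProduct_mulVec_nonneg hQs (by simpa using hQnn)
  have hVs : ∀ (Z : Matrix ι ι ℝ) (γ : ℝ), Z.IsSymm →
      (A * Z + Z * Aᵀ + γ • (B * Bᵀ)).IsSymm := by
    intro Z γ hZ
    simp only [IsSymm, transpose_add, transpose_mul, transpose_smul, transpose_transpose, hZ.eq]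
    rw [add_comm (A * Z)]
  have hV' : ∀ (Z : Matrix ι ι ℝ) (γ : ℝ), Z.PosDef →
      (Q * (A * Z + Z * Aᵀ)).trace + γ * (Q * (B * Bᵀ)).trace ≤ -u := by
    intro Z γ hZ
    have := hfV _ ⟨Z, γ, hZ, rfl⟩
    rw [hf (hVs Z γ hZ.isHermitian), mul_add, trace_add, mul_smul_comm, trace_smul,
      smul_eq_mul] at this
    linarith
  have hQ0 : Q ≠ 0 := by
    intro h0
    have h1 := hfU 1 hone
    have h2 := hV' 1 0 .one
    rw [hf isSymm_one, h0] at h1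
    rw [h0] at h2
    simp at h1 h2
    linarith
  -- `γ` ranges over all of `ℝ`, so its coefficient in a bounded expression must vanish; the chosen
  -- `γ` makes the left side `-u + 1`.
  have htr : (Q * (B * Bᵀ)).trace = 0 := by
    by_contra hne
    have := hV' 1 ((-u - (Q * (A * 1 + 1 * Aᵀ)).trace + 1) / (Q * (B * Bᵀ)).trace) .one
    rw [div_mul_cancel₀ _ hne] at this
    linarith
  have hBQB : (Bᵀ * Q * B).trace = 0 := by
    rw [trace_mul_comm, ← Matrix.mul_assoc, trace_mul_comm, htr]
  have hQB : Q * B = 0 := by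
    have hps : (Bᵀ * Q * B).PosSemidef := by
      simpa using hQ.conjTranspose_mul_mul_same B
    have h0 := (hps.trace_eq_zero_iff).1 hBQB
    ext i j
    have h3 : (Q *ᵥ (fun k => B k j)) = 0 := by
      rw [← hQ.dotProduct_mulVec_zero_iff]
      have := congrFun (congrFun h0 j) j
      rw [Matrix.mul_assoc, mul_apply] at this
      simpa [dotProduct, mul_apply, mulVec] using this
    exact congrFun h3 i
  refine ⟨Q, hQ, hQ0, hQB, .of_dotProduct_mulVec_nonneg ?_ ?_⟩
  · simp only [IsHermitian, conjTranspose_eq_transpose_of_trivial, transpose_neg, transpose_add,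
      transpose_mul, transpose_transpose, hQs.eq]
    rw [add_comm]
  · intro x
    have key : ∀ Z : Matrix ι ι ℝ,
        (Q * (A * Z + Z * Aᵀ)).trace = ((Aᵀ * Q + Q * A) * Z).trace := by
      intro Z
      rw [mul_add, add_mul, trace_add, trace_add, add_comm, ← mul_assoc Q A, ← mul_assoc Q Z,
        trace_mul_comm (Q * Z) Aᵀ, ← mul_assoc]
    rw [neg_mulVec, dotProduct_neg, star_trivial]
    refine nonneg_of_forall_pos_le_mul (b := -(Aᵀ * Q + Q * A).trace) fun ε hε => ?_
    have hpd : (vecMulVec x x + ε • (1 : Matrix ι ι ℝ)).PosDef :=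
      PosDef.posSemidef_add (by simpa using posSemidef_vecMulVec_self_star x) (PosDef.one.smul hε)
    have := hV' _ 0 hpd
    rw [key, mul_add, trace_add, trace_mul_vecMulVec_self, mul_smul_comm, trace_smul, mul_one,
      smul_eq_mul] at this
    linarith

/-! ### Uncontrollable modes from the dual alternative -/

/-- `z` is the eigenvalue of a complex left eigenvector of `A` annihilating `B`. -/
def HasUncontrollableMode [Fintype ι] (A : Matrix ι ι ℝ) (B : Matrix ι κ ℝ) (z : ℂ) : Prop :=
  ∃ v : ι → ℂ, v ≠ 0 ∧ v ᵥ* A.map Complex.ofRealHom = z • v ∧ v ᵥ* B.map Complex.ofRealHom = 0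

lemma re_mulVec_map [Fintype κ] (M : Matrix ι κ ℝ) (v : κ → ℂ) (i : ι) :
    ((M.map Complex.ofRealHom *ᵥ v) i).re = (M *ᵥ fun j => (v j).re) i := by
  simp [mulVec, dotProduct]

lemma im_mulVec_map [Fintype κ] (M : Matrix ι κ ℝ) (v : κ → ℂ) (i : ι) :
    ((M.map Complex.ofRealHom *ᵥ v) i).im = (M *ᵥ fun j => (v j).im) i := by
  simp [mulVec, dotProduct]

lemma re_vecMul_map [Fintype ι] (M : Matrix ι κ ℝ) (v : ι → ℂ) (j : κ) :
    ((v ᵥ* M.map Complex.ofRealHom) j).re = ((fun i => (v i).re) ᵥ* M) j := by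
  simp [vecMul, dotProduct]

lemma im_vecMul_map [Fintype ι] (M : Matrix ι κ ℝ) (v : ι → ℂ) (j : κ) :
    ((v ᵥ* M.map Complex.ofRealHom) j).im = ((fun i => (v i).im) ᵥ* M) j := by
  simp [vecMul, dotProduct]

lemma transpose_mulVec_re_of_eigen [Fintype ι] {A : Matrix ι ι ℝ} {v : ι → ℂ} {z : ℂ}
    (h : v ᵥ* A.map Complex.ofRealHom = z • v) :
    Aᵀ *ᵥ (fun i => (v i).re) = z.re • (fun i => (v i).re) - z.im • fun i => (v i).im := by
  ext i
  rw [mulVec_transpose, ← re_vecMul_map, h]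
  simp

lemma transpose_mulVec_im_of_eigen [Fintype ι] {A : Matrix ι ι ℝ} {v : ι → ℂ} {z : ℂ}
    (h : v ᵥ* A.map Complex.ofRealHom = z • v) :
    Aᵀ *ᵥ (fun i => (v i).im) = z.re • (fun i => (v i).im) + z.im • fun i => (v i).re := by
  ext i
  rw [mulVec_transpose, ← im_vecMul_map, h]
  simp

lemma HasUncontrollableMode.neg [Fintype ι] {A : Matrix ι ι ℝ} {B : Matrix ι κ ℝ} {z : ℂ}
    (h : HasUncontrollableMode (-A) B z) : HasUncontrollableMode A B (-z) := by
  obtain ⟨v, hv, h1, h2⟩ := h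
  refine ⟨v, hv, ?_, h2⟩
  have : (-A).map Complex.ofRealHom = -A.map Complex.ofRealHom := by ext; simp
  rw [this, vecMul_neg] at h1
  rw [neg_smul, ← h1, neg_neg]

/-- Each row of `P` vanishes on the common kernel of the rows of `Q`, so it is a combination of
them; the coefficients form a row of `N`. -/
lemma exists_mul_eq_of_ker_le [Fintype ι] [Fintype κ] [DecidableEq κ] (P Q : Matrix ι κ ℝ)
    (h : ∀ x, Q *ᵥ x = 0 → P *ᵥ x = 0) :
    ∃ N : Matrix ι ι ℝ, P = N * Q := by
  have hrow : ∀ i, ∃ c : ι → ℝ, ∀ x, (P *ᵥ x) i = ∑ j, c j * (Q *ᵥ x) j := by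
    intro i
    have := mem_span_of_iInf_ker_le_ker (L := fun j => LinearMap.proj j ∘ₗ Q.mulVecLin)
      (K := LinearMap.proj i ∘ₗ P.mulVecLin) (by
        intro x hx
        simp only [Submodule.mem_iInf, LinearMap.mem_ker, LinearMap.comp_apply,
          LinearMap.proj_apply, mulVecLin_apply] at hx ⊢
        rw [h x (funext hx), Pi.zero_apply])
    obtain ⟨c, hc⟩ := (Submodule.mem_span_range_iff_exists_fun ℝ).1 this
    refine ⟨c, fun x => ?_⟩
    have := LinearMap.congr_fun hc x
    simpa using this.symm
  choose c hc using hrow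
  refine ⟨Matrix.of c, ?_⟩
  apply Matrix.ext_of_mulVec_single
  intro k
  ext i
  rw [← mulVec_mulVec, hc]
  rfl

/-- A nonzero positive semidefinite `Q` with `QB = 0` and `AᵀQ + QA ≤ 0` yields an uncontrollable
mode in the closed left half-plane. -/
theorem exists_hasUncontrollableMode_of_posSemidef [Fintype ι] [DecidableEq ι]
    {A Q : Matrix ι ι ℝ} {B : Matrix ι κ ℝ} (hQ : Q.PosSemidef) (hQ0 : Q ≠ 0) (hQB : Q * B = 0)
    (hR : (-(Aᵀ * Q + Q * A)).PosSemidef) : ∃ z : ℂ, z.re ≤ 0 ∧ HasUncontrollableMode A B z := by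
  have hQs : Q.IsSymm := hQ.isHermitian
  have hquad : ∀ x, x ⬝ᵥ (-(Aᵀ * Q + Q * A)) *ᵥ x = -(2 * (Q *ᵥ x ⬝ᵥ A *ᵥ x)) := fun x => by
    rw [neg_mulVec, dotProduct_neg, dotProduct_conj_add A Q hQs]
  -- `ker Q` is `A`-invariant: on it the form of `-(AᵀQ + QA) ≥ 0` vanishes, so this matrix kills
  -- `x`, leaving `QAx = 0`.
  obtain ⟨N, hN⟩ : ∃ N : Matrix ι ι ℝ, Q * A = N * Q := by
    refine exists_mul_eq_of_ker_le _ _ fun x hx => ?_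
    have h0 : (-(Aᵀ * Q + Q * A)) *ᵥ x = 0 := by
      rw [← hR.dotProduct_mulVec_zero_iff, star_trivial, hquad, hx]; simp
    rw [neg_mulVec, add_mulVec, ← mulVec_mulVec, hx] at h0
    simpa using h0
  have hN' : Aᵀ * Q = Q * Nᵀ := by
    have := congrArg transpose hN
    rwa [transpose_mul, transpose_mul, hQs.eq] at this
  let φ := Complex.ofRealHom
  have hNc : (A.map φ)ᵀ * Q.map φ = Q.map φ * (N.map φ)ᵀ := by
    rw [← transpose_map, ← transpose_map, ← Matrix.map_mul, ← Matrix.map_mul, hN']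
  let W := LinearMap.range (Q.map φ).mulVecLin
  have hW : ∀ w ∈ W, (A.map φ)ᵀ.mulVecLin w ∈ W := by
    rintro _ ⟨x, rfl⟩
    refine ⟨(N.map φ)ᵀ *ᵥ x, ?_⟩
    simp only [mulVecLin_apply, mulVec_mulVec, hNc]
  have hWn : Nontrivial W := by
    rw [Submodule.nontrivial_iff_ne_bot]
    intro hbot
    rw [LinearMap.range_eq_bot] at hbot
    apply hQ0
    ext i j
    have := congrFun (LinearMap.congr_fun hbot (Pi.single j 1)) i
    simpa [φ] using this
  obtain ⟨z, hz⟩ := Module.End.exists_eigenvalue ((A.map φ)ᵀ.mulVecLin.restrict hW)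
  obtain ⟨⟨w, hw⟩, hw1⟩ := hz.exists_hasEigenvector
  have hw0 : w ≠ 0 := fun h => hw1.2 (Subtype.ext h)
  have hwz : w ᵥ* A.map φ = z • w := by
    have := congrArg Subtype.val hw1.apply_eq_smul
    simpa [mulVec_transpose] using this
  obtain ⟨x, rfl⟩ := hw
  rw [mulVecLin_apply] at hw0 hwz
  refine ⟨z, ?_, _, hw0, hwz, ?_⟩
  · set a : ι → ℝ := fun i => (x i).re
    set b : ι → ℝ := fun i => (x i).im
    have hp : (fun i => ((Q.map φ *ᵥ x) i).re) = Q *ᵥ a := funext (re_mulVec_map Q x)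
    have hq : (fun i => ((Q.map φ *ᵥ x) i).im) = Q *ᵥ b := funext (im_mulVec_map Q x)
    have e1 := transpose_mulVec_re_of_eigen hwz
    have e2 := transpose_mulVec_im_of_eigen hwz
    rw [hp, hq] at e1 e2
    have hA : ∀ y, Q *ᵥ y ⬝ᵥ A *ᵥ y = y ⬝ᵥ Aᵀ *ᵥ (Q *ᵥ y) := fun y => by
      rw [dotProduct_mulVec, ← mulVec_transpose, dotProduct_comm]
    have ha := hR.dotProduct_mulVec_nonneg a
    have hb := hR.dotProduct_mulVec_nonneg b
    rw [star_trivial, hquad, hA, e1, dotProduct_sub, dotProduct_smul, dotProduct_smul] at ha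
    rw [star_trivial, hquad, hA, e2, dotProduct_add, dotProduct_smul, dotProduct_smul] at hb
    have hab : a ⬝ᵥ Q *ᵥ b = b ⬝ᵥ Q *ᵥ a := by
      rw [dotProduct_mulVec, ← mulVec_transpose, hQs.eq, dotProduct_comm]
    have ha' := hQ.dotProduct_mulVec_nonneg a
    have hb' := hQ.dotProduct_mulVec_nonneg b
    rw [star_trivial] at ha' hb'
    simp only [smul_eq_mul, hab] at ha hb
    -- Adding `ha` and `hb` cancels the `z.im` terms. If `Re z > 0`, both `aᵀQa` and `bᵀQb` vanish,
    -- and so does the eigenvector `Q(a + ib)`.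
    by_contra! hpos
    have hsum : z.re * (a ⬝ᵥ Q *ᵥ a + b ⬝ᵥ Q *ᵥ b) ≤ 0 := by linarith
    have hle := nonpos_of_mul_nonpos_right hsum hpos
    have ha0 : Q *ᵥ a = 0 := by
      rw [← hQ.dotProduct_mulVec_zero_iff, star_trivial]; linarith
    have hb0 : Q *ᵥ b = 0 := by
      rw [← hQ.dotProduct_mulVec_zero_iff, star_trivial]; linarith
    apply hw0
    ext i
    apply Complex.ext
    · rw [re_mulVec_map]; exact congrFun ha0 i
    · rw [im_mulVec_map]; exact congrFun hb0 i
  · have : (B.map φ)ᵀ * Q.map φ = 0 := by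
      have h := congrArg transpose hQB
      rw [transpose_mul, hQs.eq] at h
      rw [← transpose_map, ← Matrix.map_mul, h]
      ext; simp [φ]
    rw [← mulVec_transpose, mulVec_mulVec, this, zero_mulVec]

/-! ### Boundedness of the solution set -/

lemma exists_neg_eigen_of_not_posSemidef [Fintype ι] [DecidableEq ι] {M : Matrix ι ι ℝ}
    (hM : M.IsSymm) (h : ¬ M.PosSemidef) : ∃ δ < (0 : ℝ), ∃ u : ι → ℝ, u ≠ 0 ∧ M *ᵥ u = δ • u := by
  have hH : M.IsHermitian := hM
  rw [hH.posSemidef_iff_eigenvalues_nonneg, Pi.le_def] at h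
  push Not at h
  obtain ⟨i, hi⟩ := h
  refine ⟨_, hi, _, ?_, hH.mulVec_eigenvectorBasis i⟩
  intro h0
  exact hH.eigenvectorBasis.orthonormal.ne_zero i (by ext j; exact congrFun h0 j)

/-- A symmetric `X` with `X + γP` not positive semidefinite, where `P > 0`, has a generalized
eigenvalue below `-γ` relative to `P`. -/
lemma exists_generalized_eigen [Fintype ι] [DecidableEq ι] {X P : Matrix ι ι ℝ} (hX : X.IsSymm)
    (hP : P.PosDef) {γ : ℝ} (h : ¬ (X + γ • P).PosSemidef) :
    ∃ d > γ, ∃ v : ι → ℝ, v ≠ 0 ∧ X *ᵥ v = -(d • P *ᵥ v) := by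
  obtain ⟨L, hL, rfl⟩ : ∃ L : Matrix ι ι ℝ, IsUnit L ∧ P = Lᵀ * L := by
    obtain ⟨L, hL⟩ := CStarAlgebra.nonneg_iff_eq_star_mul_self.1 hP.posSemidef.nonneg
    rw [star_eq_conjTranspose, conjTranspose_eq_transpose_of_trivial] at hL
    refine ⟨L, ?_, hL⟩
    have := hP.isUnit
    rw [hL, isUnit_iff_isUnit_det, det_mul] at this
    exact (isUnit_iff_isUnit_det _).2 (isUnit_of_mul_isUnit_right this)
  have hdet := (isUnit_iff_isUnit_det _).1 hL
  have hdet' : IsUnit Lᵀ.det := by rwa [det_transpose]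
  -- Congruence by `L⁻¹` turns `P` into the identity, so an ordinary eigenvector suffices.
  set M := L⁻¹ᵀ * X * L⁻¹ with hMdef
  have hXM : X = Lᵀ * M * L := by
    rw [hMdef, transpose_nonsing_inv]
    simp only [mul_assoc, nonsing_inv_mul _ hdet, mul_one, mul_nonsing_inv_cancel_left _ _ hdet']
  have hM : (M + γ • (1 : Matrix ι ι ℝ)).IsSymm := by
    simp only [IsSymm, hMdef, transpose_add, transpose_mul, transpose_smul, transpose_transpose,
      hX.eq, transpose_one, mul_assoc]
  have hns : ¬ (M + γ • (1 : Matrix ι ι ℝ)).PosSemidef := by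
    intro hps
    apply h
    have := hps.conjTranspose_mul_mul_same L
    rw [conjTranspose_eq_transpose_of_trivial, mul_add, add_mul, ← hXM] at this
    simpa using this
  obtain ⟨δ, hδ, u, hu, hMu⟩ := exists_neg_eigen_of_not_posSemidef hM hns
  have hMu' : M *ᵥ u = (δ - γ) • u := by
    rw [add_mulVec, smul_mulVec, one_mulVec] at hMu
    rw [sub_smul, ← hMu, add_sub_cancel_right]
  have hLu : L *ᵥ (L⁻¹ *ᵥ u) = u := by
    rw [mulVec_mulVec, mul_nonsing_inv _ hdet, one_mulVec]
  refine ⟨γ - δ, by linarith, L⁻¹ *ᵥ u, ?_, ?_⟩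
  · intro h0
    rw [h0, mulVec_zero] at hLu
    exact hu hLu.symm
  · rw [hXM, ← mulVec_mulVec, hLu, ← mulVec_mulVec, hMu', ← mulVec_mulVec, hLu, mulVec_smul,
      ← neg_smul, neg_sub]

theorem bddBelow_ariSolutionSet {n m : ℕ} {A : Matrix (Fin n) (Fin n) ℝ}
    {B : Matrix (Fin n) (Fin m) ℝ} (h : ∀ z, HasUncontrollableMode A B z → 0 < z.re) :
    BddBelow (ariSolutionSet A B) := by
  rcases exists_posDef_or_exists_posSemidef A B with ⟨Z, γ, hZ, hpos⟩ | ⟨Q, hQ, hQ0, hQB, hR⟩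
  swap
  · obtain ⟨z, hz, hm⟩ := exists_hasUncontrollableMode_of_posSemidef hQ hQ0 hQB hR
    exact absurd (h z hm) hz.not_gt
  have hZdet := (isUnit_iff_isUnit_det _).1 hZ.isUnit
  -- The maximum with `0` forces `d > 0` below, allowing division by `d`.
  refine ⟨-((max γ 0) • Z⁻¹), ?_⟩
  rintro X ⟨hX, hric⟩
  rw [Matrix.le_iff, sub_neg_eq_add]
  by_contra hns
  obtain ⟨d, hd, v, hv, hXv⟩ := exists_generalized_eigen hX hZ.inv hns
  have hd0 : 0 < d := (le_max_right _ _).trans_lt hd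
  have hdγ : γ < d := (le_max_left _ _).trans_lt hd
  set w := Z⁻¹ *ᵥ v with hw
  have hZw : Z *ᵥ w = v := by rw [hw, mulVec_mulVec, mul_nonsing_inv _ hZdet, one_mulVec]
  have hw0 : w ≠ 0 := by
    rintro h0
    rw [h0, mulVec_zero] at hZw
    exact hv hZw.symm
  have h1 := hpos w hw0
  have hBB : ∀ x : Fin n → ℝ, x ⬝ᵥ (B * Bᵀ) *ᵥ x = Bᵀ *ᵥ x ⬝ᵥ Bᵀ *ᵥ x := fun x => by
    rw [← mulVec_mulVec, dotProduct_mulVec, ← mulVec_transpose]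
  have hAZ := dotProduct_conj_add Aᵀ Z hZ.isHermitian w
  rw [transpose_transpose, hZw] at hAZ
  rw [add_mulVec, dotProduct_add, hAZ, smul_mulVec, dotProduct_smul, hBB, smul_eq_mul] at h1
  have h2 := (Matrix.le_iff.1 hric).dotProduct_mulVec_nonneg v
  have hsplit : v ⬝ᵥ (0 - ric A B X) *ᵥ v =
      v ⬝ᵥ (Aᵀ * X + X * A) *ᵥ v - v ⬝ᵥ (X * B * Bᵀ * X) *ᵥ v := by
    rw [← dotProduct_sub, ← sub_mulVec, ric]
    congr 2; abel
  have hXB : v ⬝ᵥ (X * B * Bᵀ * X) *ᵥ v = d ^ 2 * (Bᵀ *ᵥ w ⬝ᵥ Bᵀ *ᵥ w) := by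
    have : X * B * Bᵀ * X = X * ((B * Bᵀ) * X) := by simp only [Matrix.mul_assoc]
    rw [this, ← mulVec_mulVec, ← mulVec_mulVec, dotProduct_mulVec, ← mulVec_transpose, hX.eq, hXv,
      mulVec_neg, mulVec_smul, neg_dotProduct_neg, smul_dotProduct, dotProduct_smul, hBB,
      smul_eq_mul, smul_eq_mul]
    ring
  rw [star_trivial, hsplit, dotProduct_conj_add A X hX, hXB, hXv, neg_dotProduct, smul_dotProduct,
    dotProduct_mulVec, ← mulVec_transpose, dotProduct_comm, smul_eq_mul] at h2
  -- This is `vᵀ Ric(X) v ≤ 0` with `v = Zw`. Division by `d` and `d > γ` contradict `h1`.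
  have h3 : d * (2 * (v ⬝ᵥ Aᵀ *ᵥ w) + d * (Bᵀ *ᵥ w ⬝ᵥ Bᵀ *ᵥ w)) ≤ 0 := by
    linarith
  have h4 := nonpos_of_mul_nonpos_right h3 hd0
  have h5 : 0 ≤ Bᵀ *ᵥ w ⬝ᵥ Bᵀ *ᵥ w := by simpa using dotProduct_star_self_nonneg (Bᵀ *ᵥ w)
  have h6 := mul_le_mul_of_nonneg_right hdγ.le h5
  linarith

/-- Time reversal leaves `ric` unchanged; it exchanges the half-planes and lower with upper bounds.
-/
lemma neg_mem_ariSolutionSet_neg {n m : ℕ} {A X : Matrix (Fin n) (Fin n) ℝ}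
    {B : Matrix (Fin n) (Fin m) ℝ} (h : X ∈ ariSolutionSet A B) :
    -X ∈ ariSolutionSet (-A) B := by
  refine ⟨h.1.neg, ?_⟩
  have : ric (-A) B (-X) = ric A B X := by simp [ric]
  rw [this]
  exact h.2

theorem bddAbove_ariSolutionSet {n m : ℕ} {A : Matrix (Fin n) (Fin n) ℝ}
    {B : Matrix (Fin n) (Fin m) ℝ} (h : ∀ z, HasUncontrollableMode A B z → z.re < 0) :
    BddAbove (ariSolutionSet A B) := by
  obtain ⟨K, hK⟩ := bddBelow_ariSolutionSet (A := -A) (B := B) fun z hz => by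
    simpa using h _ hz.neg
  refine ⟨-K, fun X hX => ?_⟩
  have := hK (neg_mem_ariSolutionSet_neg hX)
  rw [Matrix.le_iff] at this ⊢
  convert this using 1
  abel

/-! ### Unbounded rays of solutions -/

theorem not_bddAbove_ariSolutionSet {n m : ℕ} {A : Matrix (Fin n) (Fin n) ℝ}
    {B : Matrix (Fin n) (Fin m) ℝ} {z : ℂ} (hm : HasUncontrollableMode A B z) (hz : 0 < z.re) :
    ¬ BddAbove (ariSolutionSet A B) := by
  rintro ⟨K, hK⟩
  obtain ⟨v, hv, hA, hB⟩ := hm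
  have e1 := transpose_mulVec_re_of_eigen hA
  have e2 := transpose_mulVec_im_of_eigen hA
  have b1 : (fun i => (v i).re) ᵥ* B = 0 := by
    ext j
    rw [← re_vecMul_map, hB]; simp
  have b2 : (fun i => (v i).im) ᵥ* B = 0 := by
    ext j
    rw [← im_vecMul_map, hB]; simp
  have hpq : (fun i => (v i).re) ≠ 0 ∨ (fun i => (v i).im) ≠ 0 := by
    by_contra! hc
    exact hv (funext fun i => Complex.ext (congrFun hc.1 i) (congrFun hc.2 i))
  generalize (fun i => (v i).re) = p at *
  generalize (fun i => (v i).im) = q at *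
  set P := vecMulVec p p + vecMulVec q q with hPdef
  have hPs : P.IsSymm := by
    ext i j; simp [hPdef, vecMulVec_apply, mul_comm]
  have hPpos : P.PosSemidef := by
    simpa using (posSemidef_vecMulVec_self_star p).add (posSemidef_vecMulVec_self_star q)
  -- The `z.im` cross terms of `ppᵀ` and `qqᵀ` cancel.
  have hAP : Aᵀ * P + P * A = (2 * z.re) • P := by
    rw [hPdef, mul_add, add_mul, mul_vecMulVec, mul_vecMulVec, vecMulVec_mul, vecMulVec_mul,
      ← mulVec_transpose, ← mulVec_transpose, e1, e2]
    ext i j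
    simp [vecMulVec_apply]
    ring
  have hPB : P * B = 0 := by
    rw [hPdef, Matrix.add_mul, vecMulVec_mul, vecMulVec_mul, b1, b2]
    ext; simp [vecMulVec_apply]
  have hmem : ∀ c : ℝ, 0 ≤ c → c • P ∈ ariSolutionSet A B := by
    intro c hc
    refine ⟨hPs.smul c, ?_⟩
    have : 0 - ric A B (c • P) = (c * (2 * z.re)) • P := by
      rw [ric, Matrix.smul_mul c P B, hPB, mul_smul, ← hAP]
      simp [add_comm]
    rw [Matrix.le_iff, this]
    exact hPpos.smul (by positivity)
  have htr : 0 < P.trace := by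
    rw [hPdef, trace_add, trace_vecMulVec, trace_vecMulVec]
    have hp : 0 ≤ p ⬝ᵥ p := by simpa using dotProduct_star_self_nonneg p
    have hq : 0 ≤ q ⬝ᵥ q := by simpa using dotProduct_star_self_nonneg q
    rcases hpq with h | h
    · linarith [dotProduct_self_pos h]
    · linarith [dotProduct_self_pos h]
  have hle : ∀ c : ℝ, 0 ≤ c → c * P.trace ≤ K.trace := by
    intro c hc
    have := (Matrix.le_iff.1 (hK (hmem c hc))).trace_nonneg
    rw [trace_sub, trace_smul, smul_eq_mul] at this
    linarith
  have := hle ((|K.trace| + 1) / P.trace) (by positivity)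
  rw [div_mul_cancel₀ _ htr.ne'] at this
  linarith [le_abs_self K.trace]

theorem not_bddBelow_ariSolutionSet {n m : ℕ} {A : Matrix (Fin n) (Fin n) ℝ}
    {B : Matrix (Fin n) (Fin m) ℝ} {z : ℂ} (hm : HasUncontrollableMode A B z) (hz : z.re < 0) :
    ¬ BddBelow (ariSolutionSet A B) := by
  rintro ⟨K, hK⟩
  have hm' : HasUncontrollableMode (-A) B (-z) :=
    HasUncontrollableMode.neg (by simpa using hm)
  refine not_bddAbove_ariSolutionSet hm' (by simpa using hz) ⟨-K, fun X hX => ?_⟩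
  have hX' : -X ∈ ariSolutionSet A B := by simpa using neg_mem_ariSolutionSet_neg hX
  have := hK hX'
  rw [Matrix.le_iff] at this ⊢
  convert this using 1
  abel

/-! ### Kalman decomposition and Hautus test -/

/-- By Cayley-Hamilton, `A ^ k` is a polynomial in `A` of degree below `n`. -/
lemma vecMul_pow_mul_eq_zero_of_lt {n m : ℕ} {A : Matrix (Fin n) (Fin n) ℝ}
    {B : Matrix (Fin n) (Fin m) ℝ} {w : Fin n → ℝ}
    (h : ∀ k < n, w ᵥ* (A ^ k * B) = 0) (k : ℕ) : w ᵥ* (A ^ k * B) = 0 := by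
  rcases Nat.eq_zero_or_pos n with rfl | hn
  · rw [Subsingleton.elim w 0, zero_vecMul]
  rw [pow_eq_aeval_mod_charpoly, Polynomial.aeval_eq_sum_range, Matrix.sum_mul, vecMul_sum]
  refine Finset.sum_eq_zero fun i hi => ?_
  have hdeg : (Polynomial.X ^ k %ₘ A.charpoly).natDegree < n := by
    have := Polynomial.natDegree_modByMonic_lt (Polynomial.X ^ k) A.charpoly_monic (by
      intro h1
      have := A.charpoly_natDegree_eq_dim
      rw [h1, Polynomial.natDegree_one, Fintype.card_fin] at this
      omega)
    rwa [A.charpoly_natDegree_eq_dim, Fintype.card_fin] at this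
  rw [Matrix.smul_mul, vecMul_smul, h i (by simp at hi; omega), smul_zero]

lemma isControllable_iff {n m : ℕ} {A : Matrix (Fin n) (Fin n) ℝ}
    {B : Matrix (Fin n) (Fin m) ℝ} :
    IsControllable A B ↔ ∀ w : Fin n → ℝ, (∀ k, w ᵥ* (A ^ k * B) = 0) → w = 0 := by
  have hker : ∀ w : Fin n → ℝ,
      w ᵥ* controllabilityMatrix A B = 0 ↔ ∀ k, w ᵥ* (A ^ k * B) = 0 := by
    intro w
    constructor
    · intro h
      refine vecMul_pow_mul_eq_zero_of_lt fun k hk => ?_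
      ext j
      exact congrFun h (⟨k, hk⟩, j)
    · intro h
      ext p
      exact congrFun (h p.1) p.2
  have hrank : IsControllable A B ↔ LinearIndependent ℝ (controllabilityMatrix A B).row := by
    rw [IsControllable, rank_eq_finrank_span_row, linearIndependent_iff_card_eq_finrank_span,
      Fintype.card_fin, eq_comm]
    rfl
  rw [hrank, ← vecMul_injective_iff]
  simp only [← hker]
  constructor
  · intro h w hw
    exact h (by simpa using hw)
  · intro h w w' hw
    have := h (w - w') (by rw [sub_vecMul]; exact sub_eq_zero.2 hw)
    exact sub_eq_zero.1 this

/-- The reachable subspace of `(A, B)`: the span of the columns of all `Aᵏ B`. -/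
def reachable {n m : ℕ} (A : Matrix (Fin n) (Fin n) ℝ) (B : Matrix (Fin n) (Fin m) ℝ) :
    Submodule ℝ (Fin n → ℝ) :=
  ⨆ k : ℕ, LinearMap.range (A ^ k * B).mulVecLin

lemma pow_mul_mulVec_mem_reachable {n m : ℕ} (A : Matrix (Fin n) (Fin n) ℝ)
    (B : Matrix (Fin n) (Fin m) ℝ) (k : ℕ) (y : Fin m → ℝ) :
    (A ^ k * B) *ᵥ y ∈ reachable A B :=
  Submodule.mem_iSup_of_mem k ⟨y, rfl⟩

lemma reachable_le_iff {n m : ℕ} {A : Matrix (Fin n) (Fin n) ℝ}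
    {B : Matrix (Fin n) (Fin m) ℝ} {p : Submodule ℝ (Fin n → ℝ)} :
    reachable A B ≤ p ↔ ∀ k y, (A ^ k * B) *ᵥ y ∈ p := by
  rw [reachable, iSup_le_iff]
  refine forall_congr' fun k => ?_
  constructor
  · intro h y; exact h ⟨y, rfl⟩
  · rintro h _ ⟨y, rfl⟩; exact h y

lemma mulVec_mem_reachable {n m : ℕ} {A : Matrix (Fin n) (Fin n) ℝ}
    {B : Matrix (Fin n) (Fin m) ℝ} {x : Fin n → ℝ} (hx : x ∈ reachable A B) :
    A *ᵥ x ∈ reachable A B := by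
  have : reachable A B ≤ (reachable A B).comap A.mulVecLin :=
    reachable_le_iff.2 fun k y => by
      rw [Submodule.mem_comap, mulVecLin_apply, mulVec_mulVec, ← Matrix.mul_assoc, ← pow_succ']
      exact pow_mul_mulVec_mem_reachable A B (k + 1) y
  exact this hx

lemma fromBlocks_zero₂₁_pow_mul_fromRows {r s m : ℕ} (A₁₁ : Matrix (Fin r) (Fin r) ℝ)
    (A₁₂ : Matrix (Fin r) (Fin s) ℝ) (A₂₂ : Matrix (Fin s) (Fin s) ℝ)
    (B₁ : Matrix (Fin r) (Fin m) ℝ) (k : ℕ) :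
    fromBlocks A₁₁ A₁₂ 0 A₂₂ ^ k * fromRows B₁ (0 : Matrix (Fin s) (Fin m) ℝ) = fromRows (A₁₁ ^ k * B₁) 0 := by
  induction k with
  | zero => simp
  | succ k ih =>
    rw [pow_succ', Matrix.mul_assoc, ih, fromBlocks_mul_fromRows, pow_succ']
    simp [Matrix.mul_assoc]

/-- In a basis adapted to the reachable subspace and a complement, the zero blocks express that this
subspace is `A`-invariant and contains the range of `B`. -/
theorem exists_isControllabilityDecomposition {n m : ℕ} (A : Matrix (Fin n) (Fin n) ℝ)
    (B : Matrix (Fin n) (Fin m) ℝ) :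
    ∃ (r s : ℕ) (T : Matrix (Fin n) (Fin r ⊕ Fin s) ℝ) (S : Matrix (Fin r ⊕ Fin s) (Fin n) ℝ)
      (A₁₁ : Matrix (Fin r) (Fin r) ℝ) (A₁₂ : Matrix (Fin r) (Fin s) ℝ)
      (A₂₂ : Matrix (Fin s) (Fin s) ℝ) (B₁ : Matrix (Fin r) (Fin m) ℝ),
      IsControllabilityDecomposition A B T S A₁₁ A₁₂ A₂₂ B₁ := by
  obtain ⟨C, hC⟩ := (reachable A B).exists_isCompl
  let b : Module.Basis (Fin (Module.finrank ℝ (reachable A B)) ⊕ Fin (Module.finrank ℝ C)) ℝ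
      (Fin n → ℝ) :=
    ((Module.finBasis ℝ (reachable A B)).prod (Module.finBasis ℝ C)).map
      (Submodule.prodEquivOfIsCompl _ _ hC)
  have hbl : ∀ i, b (Sum.inl i) ∈ reachable A B := fun i => by simp [b]
  have hrepr : ∀ x ∈ reachable A B, ∀ j, b.repr x (Sum.inr j) = 0 := by
    intro x hx j
    have : (Submodule.prodEquivOfIsCompl _ _ hC).symm x = (⟨x, hx⟩, 0) :=
      Submodule.prodEquivOfIsCompl_symm_apply_left _ _ hC ⟨x, hx⟩
    simp [b, this]
  let e := Pi.basisFun ℝ (Fin n)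
  let T := e.toMatrix b
  let S := b.toMatrix e
  have hTS : T * S = 1 := e.toMatrix_mul_toMatrix_flip b
  have hST : S * T = 1 := b.toMatrix_mul_toMatrix_flip e
  have hS : ∀ x, S *ᵥ x = b.repr x := fun x =>
    e.toMatrix_mulVec_repr b x
  have hT : ∀ i, T *ᵥ Pi.single i 1 = b i := fun i => by
    ext j
    simp [T, e, Module.Basis.toMatrix_apply]
  set M := S * A * T with hM
  have hM0 : M.toBlocks₂₁ = 0 := by
    ext i j
    have h1 : M (Sum.inr i) (Sum.inl j) = (M *ᵥ Pi.single (Sum.inl j) 1) (Sum.inr i) := by simp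
    rw [toBlocks₂₁, of_apply, h1, hM, ← mulVec_mulVec, ← mulVec_mulVec, hT, hS]
    exact hrepr _ (mulVec_mem_reachable (hbl j)) i
  have hB0 : (S * B).toRows₂ = 0 := by
    ext i j
    have h1 : (S * B) (Sum.inr i) j = ((S * B) *ᵥ Pi.single j 1) (Sum.inr i) := by simp
    rw [toRows₂_apply, h1, ← mulVec_mulVec, hS]
    have := pow_mul_mulVec_mem_reachable A B 0 (Pi.single j 1)
    rw [pow_zero, Matrix.one_mul] at this
    exact hrepr _ this i
  have hMb : M = fromBlocks M.toBlocks₁₁ M.toBlocks₁₂ 0 M.toBlocks₂₂ := by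
    rw [← hM0, fromBlocks_toBlocks]
  have hBb : S * B = fromRows (S * B).toRows₁ 0 := by
    rw [← hB0, fromRows_toRows]
  refine ⟨_, _, T, S, M.toBlocks₁₁, M.toBlocks₁₂, M.toBlocks₂₂, (S * B).toRows₁,
    hTS, hST, hMb, hBb, ?_⟩
  rw [isControllable_iff]
  intro w hw
  have hpow : ∀ k, S * A ^ k = M ^ k * S := by
    intro k
    induction k with
    | zero => simp
    | succ k ih =>
      rw [pow_succ, ← Matrix.mul_assoc, ih, pow_succ, hM]
      simp only [Matrix.mul_assoc, hTS, Matrix.mul_one]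
  -- The functional `(w, 0)S` kills the reachable subspace; its values on the reachable basis
  -- vectors are the entries of `w`.
  have hle : reachable A B ≤
      LinearMap.ker (dotProductBilin ℝ ℝ (Sum.elim w 0 ᵥ* S)) := by
    refine reachable_le_iff.2 fun k y => ?_
    rw [LinearMap.mem_ker]
    change (Sum.elim w 0 ᵥ* S) ⬝ᵥ ((A ^ k * B) *ᵥ y) = 0
    rw [dotProduct_mulVec, vecMul_vecMul, ← Matrix.mul_assoc, hpow, Matrix.mul_assoc, hMb, hBb,
      fromBlocks_zero₂₁_pow_mul_fromRows, vecMul_fromRows]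
    simp [hw k]
  ext i
  have h1 : (Sum.elim w 0 ᵥ* S) ⬝ᵥ b (Sum.inl i) = 0 := hle (hbl i)
  rw [← hT, dotProduct_mulVec, vecMul_vecMul, hST, vecMul_one] at h1
  simpa using h1

/-- Left and right eigenvalues agree, as both detect singularity of `M - z`. -/
lemma hasEigenvalue_toLin'_iff_exists_vecMul {s : ℕ} {M : Matrix (Fin s) (Fin s) ℂ} {z : ℂ} :
    Module.End.HasEigenvalue (toLin' M) z ↔ ∃ y : Fin s → ℂ, y ≠ 0 ∧ y ᵥ* M = z • y := by
  have h1 : Module.End.HasEigenvalue (toLin' M) z ↔ ∃ y, y ≠ 0 ∧ (M - z • 1) *ᵥ y = 0 := by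
    constructor
    · intro h
      obtain ⟨y, hy⟩ := h.exists_hasEigenvector
      have := hy.apply_eq_smul
      rw [toLin'_apply] at this
      exact ⟨y, hy.2, by rw [sub_mulVec, smul_mulVec, one_mulVec, this, sub_self]⟩
    · rintro ⟨y, hy, h⟩
      rw [sub_mulVec, smul_mulVec, one_mulVec, sub_eq_zero] at h
      exact Module.End.hasEigenvalue_of_hasEigenvector
        (Module.End.hasEigenvector_iff.2 ⟨Module.End.mem_eigenspace_iff.2 h, hy⟩)
  rw [h1, exists_mulVec_eq_zero_iff, ← exists_vecMul_eq_zero_iff]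
  refine exists_congr fun y => and_congr_right fun _ => ?_
  rw [vecMul_sub, vecMul_smul, vecMul_one, sub_eq_zero]

/-- A left eigenvector `y` of `A₂₂` lifts to the mode `(0, y)S`. -/
theorem IsUncontrollableEigenvalue.hasUncontrollableMode {n m : ℕ}
    {A : Matrix (Fin n) (Fin n) ℝ} {B : Matrix (Fin n) (Fin m) ℝ} {z : ℂ}
    (h : IsUncontrollableEigenvalue A B z) : HasUncontrollableMode A B z := by
  obtain ⟨r, s, T, S, A₁₁, A₁₂, A₂₂, B₁, hd, hz⟩ := h
  obtain ⟨y, hy, hyz⟩ := hasEigenvalue_toLin'_iff_exists_vecMul.1 hz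
  let φ := Complex.ofRealHom
  replace hyz : y ᵥ* A₂₂.map φ = z • y := hyz
  have hST : S.map φ * T.map φ = 1 := by
    rw [← Matrix.map_mul, hd.inv_mul]; simp
  have hSA : S.map φ * A.map φ = fromBlocks (A₁₁.map φ) (A₁₂.map φ) 0 (A₂₂.map φ) * S.map φ := by
    have : S * A = fromBlocks A₁₁ A₁₂ 0 A₂₂ * S := by
      rw [← hd.conj_A, Matrix.mul_assoc _ T S, hd.mul_inv, Matrix.mul_one]
    rw [← Matrix.map_mul, this, Matrix.map_mul, fromBlocks_map]
    simp
  have hSB : S.map φ * B.map φ = fromRows (B₁.map φ) 0 := by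
    rw [← Matrix.map_mul, hd.conj_B, fromRows_map]
    simp
  refine ⟨Sum.elim 0 y ᵥ* S.map φ, ?_, ?_, ?_⟩
  · intro h0
    have := congrArg (· ᵥ* T.map φ) h0
    simp only [vecMul_vecMul, hST, vecMul_one, zero_vecMul] at this
    exact hy (funext fun i => congrFun this (Sum.inr i))
  · have : Sum.elim 0 y ᵥ* fromBlocks (A₁₁.map φ) (A₁₂.map φ) 0 (A₂₂.map φ) =
        z • (Sum.elim 0 y : Fin r ⊕ Fin s → ℂ) := by
      rw [vecMul_fromBlocks]
      ext (i | i) <;> simp [hyz]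
    rw [vecMul_vecMul]
    change _ ᵥ* (S.map φ * A.map φ) = _
    rw [hSA, ← vecMul_vecMul, this, smul_vecMul]
  · rw [vecMul_vecMul]
    change _ ᵥ* (S.map φ * B.map φ) = _
    rw [hSB, vecMul_fromRows]
    simp

lemma IsControllable.eq_zero_of_vecMul {n m : ℕ} {A : Matrix (Fin n) (Fin n) ℝ}
    {B : Matrix (Fin n) (Fin m) ℝ} (h : IsControllable A B) {z : ℂ} {v : Fin n → ℂ}
    (hA : v ᵥ* A.map Complex.ofRealHom = z • v) (hB : v ᵥ* B.map Complex.ofRealHom = 0) :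
    v = 0 := by
  have hk : ∀ k : ℕ, v ᵥ* (A ^ k * B).map Complex.ofRealHom = 0 := by
    intro k
    have hp : v ᵥ* (A ^ k).map Complex.ofRealHom = z ^ k • v := by
      induction k with
      | zero => simp
      | succ k ih => rw [pow_succ, Matrix.map_mul, ← vecMul_vecMul, ih, smul_vecMul, hA, smul_smul,
          pow_succ]
    rw [Matrix.map_mul, ← vecMul_vecMul, hp, smul_vecMul, hB, smul_zero]
  rw [isControllable_iff] at h
  have hre := h (fun i => (v i).re) fun k => by
    ext j
    rw [← re_vecMul_map, hk]; simp
  have him := h (fun i => (v i).im) fun k => by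
    ext j
    rw [← im_vecMul_map, hk]; simp
  exact funext fun i => Complex.ext (congrFun hre i) (congrFun him i)

/-- Write `vT = (a, b)`. Then `a` is an uncontrollable mode of the controllable pair `(A₁₁, B₁)`
unless it vanishes; so `a = 0` and `b` is a left eigenvector of `A₂₂`. -/
theorem HasUncontrollableMode.isUncontrollableEigenvalue {n m : ℕ}
    {A : Matrix (Fin n) (Fin n) ℝ} {B : Matrix (Fin n) (Fin m) ℝ} {z : ℂ}
    (h : HasUncontrollableMode A B z) : IsUncontrollableEigenvalue A B z := by
  obtain ⟨r, s, T, S, A₁₁, A₁₂, A₂₂, B₁, hd⟩ := exists_isControllabilityDecomposition A B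
  refine ⟨r, s, T, S, A₁₁, A₁₂, A₂₂, B₁, hd, hasEigenvalue_toLin'_iff_exists_vecMul.2 ?_⟩
  obtain ⟨v, hv, hA, hB⟩ := h
  let φ := Complex.ofRealHom
  have hTS : T.map φ * S.map φ = 1 := by
    rw [← Matrix.map_mul, hd.mul_inv]; simp
  have hAT : A.map φ * T.map φ = T.map φ * fromBlocks (A₁₁.map φ) (A₁₂.map φ) 0 (A₂₂.map φ) := by
    have : A * T = T * fromBlocks A₁₁ A₁₂ 0 A₂₂ := by
      rw [← hd.conj_A, Matrix.mul_assoc S, ← Matrix.mul_assoc T S, hd.mul_inv, Matrix.one_mul]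
    rw [← Matrix.map_mul, this, Matrix.map_mul, fromBlocks_map]
    simp
  have hTB : B.map φ = T.map φ * fromRows (B₁.map φ) (0 : Matrix (Fin s) (Fin m) ℂ) := by
    have : B = T * fromRows B₁ (0 : Matrix (Fin s) (Fin m) ℝ) := by
      rw [← hd.conj_B, ← Matrix.mul_assoc, hd.mul_inv, Matrix.one_mul]
    rw [this, Matrix.map_mul, fromRows_map]
    simp
  obtain ⟨a, b, hab⟩ : ∃ a b, v ᵥ* T.map φ = Sum.elim a b :=
    ⟨_, _, (Sum.elim_comp_inl_inr _).symm⟩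
  have h1 : Sum.elim a b ᵥ* fromBlocks (A₁₁.map φ) (A₁₂.map φ) 0 (A₂₂.map φ) =
      z • Sum.elim a b := by
    rw [← hab, vecMul_vecMul, ← hAT, ← vecMul_vecMul, ← smul_vecMul]
    exact congrArg (· ᵥ* T.map φ) hA
  have h2 : a ᵥ* B₁.map φ = 0 := by
    have : v ᵥ* B.map φ = 0 := hB
    rw [hTB, ← vecMul_vecMul, hab, vecMul_fromRows] at this
    simpa using this
  rw [vecMul_fromBlocks] at h1
  have ha : a = 0 := hd.controllable.eq_zero_of_vecMul (z := z)
    (funext fun i => by simpa using congrFun h1 (Sum.inl i)) h2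
  subst ha
  have hb : b ᵥ* A₂₂.map φ = z • b := funext fun i => by simpa using congrFun h1 (Sum.inr i)
  refine ⟨b, ?_, hb⟩
  rintro rfl
  apply hv
  have h3 : v ᵥ* T.map φ ᵥ* S.map φ = v := by rw [vecMul_vecMul, hTS, vecMul_one]
  rw [← h3, hab]
  simp

end Riccati

theorem theorem8 (n m : ℕ) (A₀ : Matrix (Fin n) (Fin n) ℝ) (B : Matrix (Fin n) (Fin m) ℝ)
    (hunc : ¬ Riccati.IsControllable A₀ B) :
    ((∀ z : ℂ, Riccati.IsUncontrollableEigenvalue A₀ B z → 0 < z.re) →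
      BddBelow (Riccati.ariSolutionSet A₀ B)) ∧
    ((∀ z : ℂ, Riccati.IsUncontrollableEigenvalue A₀ B z → z.re < 0) →
      BddAbove (Riccati.ariSolutionSet A₀ B)) ∧
    (((∃ z : ℂ, Riccati.IsUncontrollableEigenvalue A₀ B z ∧ 0 < z.re) ∧
        (∃ z : ℂ, Riccati.IsUncontrollableEigenvalue A₀ B z ∧ z.re < 0)) →
      ¬ BddBelow (Riccati.ariSolutionSet A₀ B) ∧ ¬ BddAbove (Riccati.ariSolutionSet A₀ B)) := by
  refine ⟨fun h => ?_, fun h => ?_, ?_⟩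
  · exact Riccati.bddBelow_ariSolutionSet fun z hz => h z hz.isUncontrollableEigenvalue
  · exact Riccati.bddAbove_ariSolutionSet fun z hz => h z hz.isUncontrollableEigenvalue
  · rintro ⟨⟨z, hz, hz0⟩, w, hw, hw0⟩
    exact ⟨Riccati.not_bddBelow_ariSolutionSet hw.hasUncontrollableMode hw0,
      Riccati.not_bddAbove_ariSolutionSet hz.hasUncontrollableMode hz0⟩
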